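/- Let $d\ge 2$ and $0\le r_0<r_1\le\infty$, and let $A(r_0,r_1)=\{x\in\mathbb{R}^d: r_0<|x|<r_1\}$. For each $k\in\mathbb{N}_0$ let $Y_{k,l}$, $l=1,\dots,a_k$, be a basis of the $a_k$-dimensional complex vector space of harmonic homogeneous polynomials of degree $k$ on $\mathbb{R}^d$ that is orthonormal with respect to $\langle g,h\rangle=\int_{\mathbb{S}^{d-1}}g(\theta)\overline{h(\theta)}\,d\theta$, where $d\theta$ is the surface measure on the unit sphere $\mathbb{S}^{d-1}$, and let $\omega_{d-1}$ be the surface area of $\mathbb{S}^{d-1}$. Let $\tau\ge 0$ and let $f:A(r_0,r_1)\to\mathbb{C}$ be polyharmonic of infinite order and type $\tau$; that is, $f$ is $C^\infty$ and for every compact $K\subset A(r_0,r_1)$ and every $\varepsilon>0$ there is a constant $C_{K,\varepsilon}>0$ such that $\max_{x\in K}|\Delta^p f(x)|\le C_{K,\varepsilon}\,(2p)!\,(\tau+\varepsilon)^{2p}$ for all $p\in\mathbb{N}_0$. Define its Fourier--Laplace coefficients by $$f_{k,l}(r)=\int_{\mathbb{S}^{d-1}}f(r\theta)\,\overline{Y_{k,l}(\theta)}\,d\theta,\qquad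 r\in(r_0,r_1),$$ and let $$L_k=\frac{d^2}{dr^2}+\frac{d-1}{r}\frac{d}{dr}-\frac{k(k+d-2)}{r^2}.$$ Then every $f_{k,l}$ is $C^\infty$ on $(r_0,r_1)$, and for every interval $[a,b]\subset(r_0,r_1)$ and every $\varepsilon>0$ there is a constant $C_{a,b,\varepsilon}>0$ such that, for all $k\in\mathbb{N}_0$, all $l=1,\dots,a_k$, all $r\in[a,b]$ and all $p\in\mathbb{N}_0$, $$\left|L_k^p(f_{k,l})(r)\right|\le C_{a,b,\varepsilon}\,\sqrt{\omega_{d-1}}\,(2p)!\,(\tau+\varepsilon)^{2p}.$$ -/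

import Mathlib

open MeasureTheory
open scoped ContDiff

noncomputable section

namespace Polyharmonic

/-- `ℝ^d` with its Euclidean norm. -/
abbrev Euc (d : ℕ) : Type := EuclideanSpace ℝ (Fin d)

/-- The open interval `(r₀, r₁)`, where `r₁ = ∞` is allowed. -/
def radii (r₀ : ℝ) (r₁ : EReal) : Set ℝ := {r | r₀ < r ∧ (r : EReal) < r₁}

/-- The annular region `A(r₀, r₁) = {x ∈ ℝ^d : r₀ < |x| < r₁}`. -/
def annulus (d : ℕ) (r₀ : ℝ) (r₁ : EReal) : Set (Euc d) := {x | ‖x‖ ∈ radii r₀ r₁}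

/-- `f` is polyharmonic of infinite order and type `τ` on the open set `G`: it is `C^∞` on `G`,
and for every compact `K ⊆ G` and every `ε > 0` there is `C > 0` with
`|Δ^p f| ≤ C (2p)! (τ + ε)^(2p)` on `K` for all `p`.
Only the values of `f` on `G` matter, because `G` is open. -/
def IsPolyharmonicInf {d : ℕ} (G : Set (Euc d)) (τ : ℝ) (f : Euc d → ℂ) : Prop :=
  ContDiffOn ℝ ∞ f G ∧
    ∀ K : Set (Euc d), IsCompact K → K ⊆ G → ∀ ε : ℝ, 0 < ε →
      ∃ C : ℝ, 0 < C ∧ ∀ p : ℕ, ∀ x ∈ K,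
        ‖((fun g : Euc d → ℂ => Laplacian.laplacian g)^[p] f) x‖
          ≤ C * ((2 * p).factorial : ℝ) * (τ + ε) ^ (2 * p)

/-- The surface measure `dθ` on the unit sphere `S^(d-1)`. -/
def sphereMeasure (d : ℕ) : Measure (Metric.sphere (0 : Euc d) 1) :=
  (volume : Measure (Euc d)).toSphere

/-- The surface area `ω_(d-1)` of `S^(d-1)`. -/
def sphereArea (d : ℕ) : ℝ := (sphereMeasure d).real Set.univ

/-- The Laplacian `∑ i, ∂²/∂x_i²` on polynomials. -/
def polyLaplacian (d : ℕ) : MvPolynomial (Fin d) ℂ →ₗ[ℂ] MvPolynomial (Fin d) ℂ :=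
  ∑ i : Fin d, (MvPolynomial.pderiv i).toLinearMap ∘ₗ (MvPolynomial.pderiv i).toLinearMap

/-- The space of harmonic homogeneous polynomials of degree `k` in `d` variables. -/
def harmonicPoly (d k : ℕ) : Submodule ℂ (MvPolynomial (Fin d) ℂ) :=
  MvPolynomial.homogeneousSubmodule (Fin d) ℂ k ⊓ LinearMap.ker (polyLaplacian d)

/-- `a_k`, the dimension of the space of harmonic homogeneous polynomials of degree `k`. -/
def harmonicDim (d k : ℕ) : ℕ := Module.finrank ℂ (harmonicPoly d k)

/-- The value of a complex polynomial at a point of `ℝ^d`. -/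
def evalAt {d : ℕ} (P : MvPolynomial (Fin d) ℂ) (x : Euc d) : ℂ :=
  MvPolynomial.eval (fun i => ((x i : ℝ) : ℂ)) P

/-- For every `k`, the family `Y k l`, `l = 1, …, a_k` (indexed here by `Fin a_k`), is an
orthonormal basis of the harmonic homogeneous polynomials of degree `k` with respect to
`⟨f, g⟩ = ∫ f(θ) conj (g(θ)) dθ` over the unit sphere. -/
structure IsSphericalBasis (d : ℕ)
    (Y : (k : ℕ) → Fin (harmonicDim d k) → MvPolynomial (Fin d) ℂ) : Prop where
  span_eq : ∀ k, Submodule.span ℂ (Set.range (Y k)) = harmonicPoly d k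
  orthonormal : ∀ k (l m : Fin (harmonicDim d k)),
    ∫ θ, evalAt (Y k l) (θ : Euc d) * (starRingEnd ℂ) (evalAt (Y k m) (θ : Euc d))
      ∂(sphereMeasure d) = if l = m then 1 else 0

/-- The Fourier–Laplace coefficient `r ↦ ∫ f(rθ) conj (P(θ)) dθ` of `f` with respect to `P`;
for `P = Y_{k,l}` this is `f_{k,l}`. -/
def flCoeff {d : ℕ} (f : Euc d → ℂ) (P : MvPolynomial (Fin d) ℂ) (r : ℝ) : ℂ :=
  ∫ θ, f (r • (θ : Euc d)) * (starRingEnd ℂ) (evalAt P (θ : Euc d)) ∂(sphereMeasure d)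

/-- The operator `L_k = d²/dr² + ((d-1)/r) d/dr - k(k+d-2)/r²`. -/
def radialOp (d k : ℕ) (g : ℝ → ℂ) (r : ℝ) : ℂ :=
  deriv (deriv g) r + (((d : ℝ) - 1) / r : ℝ) * deriv g r
    - ((k : ℝ) * ((k : ℝ) + (d : ℝ) - 2) / r ^ 2 : ℝ) * g r

end Polyharmonic

end

/-!
Write `∂_A f (x) = Df(x)(A x)` for a linear vector field `A`. With `∂₁` the Euler operator and `Δ_S`
half the sum of the squares of the infinitesimal rotations `x_i e_j - x_j e_i`, the Laplacian on
`ℝ^d` satisfies `‖x‖² Δ = ∂₁² + (d - 2) ∂₁ + Δ_S`.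

The surface measure is rotation invariant, so infinitesimal rotations integrate to zero over the
sphere and `Δ_S` is symmetric there. If `P` is harmonic and homogeneous of degree `k`, then
`∂₁ P = k P`, and the identity gives `Δ_S P = -k (k + d - 2) P`. Differentiation under the integral
sign shows that `r d/dr` acts on the coefficient `f_P` as `∂₁` acts on `f`, which yields smoothness
of `f_P` inductively; pairing the identity with `P` therefore turns `Δ` into `L_k`, that is,
`L_k f_P = (Δ f)_P`. Hence `L_k^p f_P = (Δ^p f)_P`, and the estimate follows from Cauchy–Schwarz on
the spheres in the compact shell `a ≤ ‖x‖ ≤ b`.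
-/

namespace Polyharmonic

open Set Metric Filter Topology InnerProductSpace NormedSpace
open scoped Laplacian Pointwise

section ParametricIntegral

theorem hasDerivAt_integral_of_continuousOn_deriv {X F : Type*} [TopologicalSpace X]
    [CompactSpace X] [MeasurableSpace X] [OpensMeasurableSpace X] {μ : Measure X}
    [IsFiniteMeasure μ] [NormedAddCommGroup F] [NormedSpace ℝ F]
    [SecondCountableTopologyEither X F] {I : Set ℝ} (hI : IsOpen I)
    {G G' : ℝ → X → F} (hG : ∀ s ∈ I, Continuous (G s))
    (hG' : ContinuousOn (Function.uncurry G') (I ×ˢ univ))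
    (hderiv : ∀ s ∈ I, ∀ x, HasDerivAt (G · x) (G' s x) s) {r : ℝ} (hr : r ∈ I) :
    HasDerivAt (fun s => ∫ x, G s x ∂μ) (∫ x, G' r x ∂μ) r := by
  obtain ⟨δ, hδ, hδI⟩ := nhds_basis_closedBall.mem_iff.1 (hI.mem_nhds hr)
  obtain ⟨C, hC⟩ := ((isCompact_closedBall r δ).prod isCompact_univ).exists_bound_of_continuousOn
    (hG'.mono (prod_mono_left hδI))
  have hG'r : Continuous (G' r) := by
    simpa [Function.comp_def] using
      hG'.comp_continuous (Continuous.prodMk_right r) fun x => ⟨hr, mem_univ x⟩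
  exact (hasDerivAt_integral_of_dominated_loc_of_deriv_le (bound := fun _ => C)
    (closedBall_mem_nhds r hδ)
    (eventually_of_mem (hI.mem_nhds hr) fun s hs => (hG s hs).aestronglyMeasurable)
    ((hG r hr).integrable_of_hasCompactSupport (.of_compactSpace _))
    hG'r.aestronglyMeasurable (ae_of_all _ fun x s hs => hC (s, x) ⟨hs, mem_univ x⟩)
    (integrable_const C) (ae_of_all _ fun x s hs => hderiv s (hδI hs) x)).2

end ParametricIntegral

section FieldDeriv

variable {E F : Type*} [NormedAddCommGroup E] [NormedSpace ℝ E] [NormedAddCommGroup F]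
  [NormedSpace ℝ F]

/-- The derivative of `f` along the linear vector field `x ↦ A x`. For `A = 1` this is the Euler
operator `∑ i, xᵢ ∂ᵢ`; for skew-adjoint `A` it is the derivative along an infinitesimal rotation. -/
noncomputable def fieldDeriv (A : E →L[ℝ] E) (f : E → F) (x : E) : F := fderiv ℝ f x (A x)

theorem contDiffAt_fieldDeriv {A : E →L[ℝ] E} {f : E → F} {x : E} {m n : WithTop ℕ∞}
    (hf : ContDiffAt ℝ n f x) (hmn : m + 1 ≤ n) : ContDiffAt ℝ m (fieldDeriv A f) x :=
  (hf.fderiv_right hmn).clm_apply A.contDiff.contDiffAt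

theorem continuousAt_fieldDeriv {A : E →L[ℝ] E} {f : E → F} {x : E} (hf : ContDiffAt ℝ 1 f x) :
    ContinuousAt (fieldDeriv A f) x :=
  (contDiffAt_fieldDeriv (m := 0) hf le_rfl).continuousAt

theorem fieldDeriv_const_smul (A : E →L[ℝ] E) (c : ℝ) (f : E → F) :
    fieldDeriv A (c • f) = c • fieldDeriv A f := by
  ext x
  simp [fieldDeriv, fderiv_const_smul_field]

theorem fieldDeriv_comp_smul (A : E →L[ℝ] E) (f : E → F) (r : ℝ) :
    fieldDeriv A (fun x => f (r • x)) = fun x => fieldDeriv A f (r • x) := by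
  ext x
  simp [fieldDeriv, fderiv_comp_smul]

theorem fieldDeriv_bilin {G H : Type*} [NormedAddCommGroup G] [NormedSpace ℝ G]
    [NormedAddCommGroup H] [NormedSpace ℝ H] (A : E →L[ℝ] E) (B : F →L[ℝ] G →L[ℝ] H)
    {f : E → F} {g : E → G} {x : E} (hf : DifferentiableAt ℝ f x) (hg : DifferentiableAt ℝ g x) :
    fieldDeriv A (fun y => B (f y) (g y)) x =
      B (f x) (fieldDeriv A g x) + B (fieldDeriv A f x) (g x) := by
  simp [fieldDeriv, (B.hasFDerivAt_of_bilinear hf.hasFDerivAt hg.hasFDerivAt).fderiv]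

theorem fieldDeriv_fieldDeriv (A : E →L[ℝ] E) {f : E → F} {x : E} (hf : ContDiffAt ℝ 2 f x) :
    fieldDeriv A (fieldDeriv A f) x =
      fderiv ℝ (fderiv ℝ f) x (A x) (A x) + fderiv ℝ f x (A (A x)) := by
  have hf' : DifferentiableAt ℝ (fderiv ℝ f) x :=
    (hf.fderiv_right (m := 1) le_rfl).differentiableAt one_ne_zero
  unfold fieldDeriv
  rw [fderiv_clm_apply hf' A.differentiableAt]
  simp [add_comm]

end FieldDeriv

section SphericalLaplacian

variable {E F : Type*} [NormedAddCommGroup E] [InnerProductSpace ℝ E] [NormedAddCommGroup F]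
  [NormedSpace ℝ F]

/-- The generator `x ↦ ⟪u, x⟫ v - ⟪v, x⟫ u` of the rotations in the plane of `u` and `v`. -/
noncomputable def rotationGenerator (u v : E) : E →L[ℝ] E := rankOne ℝ v u - rankOne ℝ u v

theorem rotationGenerator_apply (u v x : E) :
    rotationGenerator u v x = inner ℝ u x • v - inner ℝ v x • u := rfl

theorem rotationGenerator_mem_skewAdjoint [CompleteSpace E] (u v : E) :
    rotationGenerator u v ∈ skewAdjoint (E →L[ℝ] E) := by
  simp [skewAdjoint.mem_iff, rotationGenerator, ContinuousLinearMap.star_eq_adjoint,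
    adjoint_rankOne]

theorem laplacian_eq_sum_fderiv_fderiv [FiniteDimensional ℝ E] {ι : Type*} [Fintype ι]
    (b : OrthonormalBasis ι ℝ E) (f : E → F) (x : E) :
    Δ f x = ∑ i, fderiv ℝ (fderiv ℝ f) x (b i) (b i) := by
  simp [laplacian_eq_iteratedFDeriv_orthonormalBasis f b, iteratedFDeriv_two_apply]

theorem contDiffAt_laplacian [FiniteDimensional ℝ E] {f : E → F} {x : E} {m n : WithTop ℕ∞}
    (hf : ContDiffAt ℝ n f x) (hmn : m + 2 ≤ n) : ContDiffAt ℝ m (Δ f) x := by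
  rw [funext (laplacian_eq_sum_fderiv_fderiv (stdOrthonormalBasis ℝ E) f)]
  have hf' : ContDiffAt ℝ (m + 1) (fderiv ℝ f) x := hf.fderiv_right (by rwa [add_assoc])
  exact .sum fun i _ => ((hf'.fderiv_right le_rfl).clm_apply contDiffAt_const).clm_apply
    contDiffAt_const

theorem contDiffAt_laplacian_iterate [FiniteDimensional ℝ E] {f : E → F} {x : E}
    (hf : ContDiffAt ℝ ∞ f x) (p : ℕ) :
    ContDiffAt ℝ ∞ ((fun g : E → F => Δ g)^[p] f) x := by
  induction p with
  | zero => exact hf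
  | succ p ih =>
    rw [Function.iterate_succ_apply']
    exact contDiffAt_laplacian ih le_rfl

section OrthonormalBasisSums

variable {ι : Type*} [Fintype ι] (b : OrthonormalBasis ι ℝ E)

theorem sum_sum_bilin_rotationGenerator (B : E →L[ℝ] E →L[ℝ] F) (x : E) :
    ∑ i, ∑ j, B (rotationGenerator (b i) (b j) x) (rotationGenerator (b i) (b j) x) =
      (2 : ℝ) • (‖x‖ ^ 2 • ∑ i, B (b i) (b i) - B x x) := by
  have hnorm : ∑ i, inner ℝ (b i) x ^ 2 = ‖x‖ ^ 2 := by simpa using b.sum_sq_norm_inner_right x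
  have hdiag : ∑ i, ∑ j, inner ℝ (b i) x ^ 2 • B (b j) (b j) = ‖x‖ ^ 2 • ∑ i, B (b i) (b i) := by
    rw [← hnorm, Finset.sum_smul_sum]
  have hcross : ∑ i, ∑ j, (inner ℝ (b i) x * inner ℝ (b j) x) • B (b j) (b i) = B x x := by
    conv_rhs => rw [← b.sum_repr' x]
    simp only [map_sum, map_smul, sum_apply, smul_apply, Finset.smul_sum, mul_smul]
  have hexpand (i j : ι) :
      B (rotationGenerator (b i) (b j) x) (rotationGenerator (b i) (b j) x) =
        (inner ℝ (b i) x ^ 2 • B (b j) (b j) + inner ℝ (b j) x ^ 2 • B (b i) (b i))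
        - ((inner ℝ (b i) x * inner ℝ (b j) x) • B (b j) (b i)
          + (inner ℝ (b j) x * inner ℝ (b i) x) • B (b i) (b j)) := by
    simp only [rotationGenerator_apply, map_sub, map_smul, sub_apply, smul_apply]
    module
  have hdiag' := Finset.sum_comm.trans hdiag
  have hcross' := Finset.sum_comm.trans hcross
  simp only [hexpand, Finset.sum_sub_distrib, Finset.sum_add_distrib, hdiag, hdiag', hcross,
    hcross']
  module

theorem sum_sum_rotationGenerator_rotationGenerator (x : E) :
    ∑ i, ∑ j, rotationGenerator (b i) (b j) (rotationGenerator (b i) (b j) x) =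
      (-2 * ((Fintype.card ι : ℝ) - 1)) • x := by
  classical
  have hexpand (i j : ι) :
      rotationGenerator (b i) (b j) (rotationGenerator (b i) (b j) x) =
        (if i = j then inner ℝ (b i) x • b j + inner ℝ (b j) x • b i else 0)
        - (inner ℝ (b i) x • b i + inner ℝ (b j) x • b j) := by
    rcases eq_or_ne i j with rfl | hij
    · simp [rotationGenerator_apply]
    · simp only [rotationGenerator_apply, inner_sub_right, inner_smul_right, b.inner_eq_ite, hij,
        hij.symm, ↓reduceIte, mul_zero, mul_one, zero_sub, sub_zero]
      module
  simp only [hexpand, Finset.sum_sub_distrib, Finset.sum_add_distrib, Finset.sum_ite_eq,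
    Finset.mem_univ, ↓reduceIte, Finset.sum_const, Finset.card_univ, b.sum_repr' x,
    ← Finset.smul_sum]
  module

end OrthonormalBasisSums

variable [FiniteDimensional ℝ E]

/-- The Laplace–Beltrami operator of the spheres centred at `0`, in the angular variable, as half
the sum of the squares of the infinitesimal rotations in all ordered pairs of coordinates. -/
noncomputable def sphericalLaplacian (f : E → F) (x : E) : F :=
  (2⁻¹ : ℝ) • ∑ i, ∑ j, fieldDeriv
    (rotationGenerator (stdOrthonormalBasis ℝ E i) (stdOrthonormalBasis ℝ E j))
    (fieldDeriv
      (rotationGenerator (stdOrthonormalBasis ℝ E i) (stdOrthonormalBasis ℝ E j)) f) x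

theorem continuousAt_sphericalLaplacian {f : E → F} {x : E} (hf : ContDiffAt ℝ 2 f x) :
    ContinuousAt (sphericalLaplacian f) x :=
  .const_smul (tendsto_finsetSum _ fun _ _ => tendsto_finsetSum _ fun _ _ =>
    continuousAt_fieldDeriv (contDiffAt_fieldDeriv hf le_rfl)) _

theorem sphericalLaplacian_comp_smul (f : E → F) (r : ℝ) :
    sphericalLaplacian (fun x => f (r • x)) = fun x => sphericalLaplacian f (r • x) := by
  ext x
  simp only [sphericalLaplacian, fieldDeriv_comp_smul]

theorem norm_sq_smul_laplacian {f : E → F} {x : E} (hf : ContDiffAt ℝ 2 f x) :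
    ‖x‖ ^ 2 • Δ f x = fieldDeriv 1 (fieldDeriv 1 f) x
      + ((Module.finrank ℝ E : ℝ) - 2) • fieldDeriv 1 f x + sphericalLaplacian f x := by
  simp only [sphericalLaplacian, fieldDeriv_fieldDeriv _ hf, Finset.sum_add_distrib, ← map_sum,
    sum_sum_bilin_rotationGenerator, sum_sum_rotationGenerator_rotationGenerator,
    ← laplacian_eq_sum_fderiv_fderiv]
  simp only [map_smul, fieldDeriv, one_apply_eq_self, Fintype.card_fin]
  module

end SphericalLaplacian

section Rotation

variable {E F : Type*} [NormedAddCommGroup E] [InnerProductSpace ℝ E]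

theorem exists_flow_of_mem_skewAdjoint [CompleteSpace E] {S : E →L[ℝ] E}
    (hS : S ∈ skewAdjoint (E →L[ℝ] E)) :
    ∃ R : ℝ → E ≃ₗᵢ[ℝ] E, (∀ x, R 0 x = x) ∧ Continuous (fun q : ℝ × E => R q.1 q.2) ∧
      ∀ t x, HasDerivAt (fun t => R t x) (S (R t x)) t := by
  let +nondep : NormedAlgebra ℚ (E →L[ℝ] E) := .restrictScalars ℚ ℝ _
  have hunitary (t : ℝ) : exp (t • S) ∈ unitary (E →L[ℝ] E) :=
    exp_mem_unitary_of_mem_skewAdjoint (skewAdjoint.smul_mem t hS)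
  have hcoe (t : ℝ) (x : E) :
      Unitary.linearIsometryEquiv ⟨_, hunitary t⟩ x = exp (t • S) x := rfl
  refine ⟨fun t => Unitary.linearIsometryEquiv ⟨_, hunitary t⟩, ?_⟩
  simp only [hcoe]
  refine ⟨fun x => by simp, ?_, fun t x => ?_⟩
  · have hexp : Continuous fun t : ℝ => exp (t • S) := exp_continuous.comp (by fun_prop)
    exact (hexp.comp continuous_fst).clm_apply continuous_snd
  · simpa using (hasDerivAt_exp_smul_const' S t).clm_apply (hasDerivAt_const t x)

variable [MeasurableSpace E] [BorelSpace E] [NormedAddCommGroup F] [NormedSpace ℝ F]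

theorem measurePreserving_toSphere {μ : Measure E} {A : E ≃ₗᵢ[ℝ] E}
    (hA : MeasurePreserving A μ μ) :
    MeasurePreserving (A.toIsometryEquiv.toHomeomorph.subtype fun x => by simp :
      sphere (0 : E) 1 ≃ₜ sphere (0 : E) 1) μ.toSphere μ.toSphere := by
  set e : sphere (0 : E) 1 ≃ₜ sphere (0 : E) 1 :=
    A.toIsometryEquiv.toHomeomorph.subtype fun x => by simp
  refine ⟨e.measurable, Measure.ext fun s hs => ?_⟩
  have hcone : Ioo (0 : ℝ) 1 • ((↑) '' (e ⁻¹' s)) = A ⁻¹' (Ioo (0 : ℝ) 1 • ((↑) '' s) : Set E) := by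
    ext x
    simp only [mem_preimage, Set.mem_smul]
    constructor
    · rintro ⟨t, ht, _, ⟨θ, hθ, rfl⟩, rfl⟩
      exact ⟨t, ht, _, ⟨e θ, hθ, rfl⟩, (map_smul A t _).symm⟩
    · rintro ⟨t, ht, _, ⟨θ, hθ, rfl⟩, hx⟩
      refine ⟨t, ht, _, ⟨e.symm θ, by simpa using hθ, rfl⟩, A.injective ?_⟩
      rw [map_smul, ← hx]
      exact congrArg (fun η : sphere (0 : E) 1 => t • (η : E)) (e.apply_symm_apply θ)
  rw [Measure.map_apply e.measurable hs, Measure.toSphere_apply' _ hs,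
    Measure.toSphere_apply' _ (e.measurable hs), hcone,
    hA.measure_preimage_emb A.toHomeomorph.measurableEmbedding]

theorem integral_toSphere_comp_linearIsometryEquiv {μ : Measure E} {A : E ≃ₗᵢ[ℝ] E}
    (hA : MeasurePreserving A μ μ) (g : E → F) :
    ∫ θ : sphere (0 : E) 1, g (A θ) ∂μ.toSphere = ∫ θ : sphere (0 : E) 1, g θ ∂μ.toSphere :=
  (measurePreserving_toSphere hA).integral_comp (Homeomorph.measurableEmbedding _) fun θ => g θ

variable [FiniteDimensional ℝ E]

theorem integral_toSphere_fieldDeriv_eq_zero {S : E →L[ℝ] E} (hS : S ∈ skewAdjoint (E →L[ℝ] E))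
    {g : E → F} (hg : ∀ x ∈ sphere (0 : E) 1, ContDiffAt ℝ 1 g x) :
    ∫ θ : sphere (0 : E) 1, fieldDeriv S g θ ∂(volume : Measure E).toSphere = 0 := by
  obtain ⟨R, hR0, hR, hRderiv⟩ := exists_flow_of_mem_skewAdjoint hS
  have hsphere (t : ℝ) (θ : sphere (0 : E) 1) : R t θ ∈ sphere (0 : E) 1 := by simp
  have hderiv : HasDerivAt (fun t => ∫ θ : sphere (0 : E) 1, g (R t θ)
      ∂(volume : Measure E).toSphere)
      (∫ θ : sphere (0 : E) 1, fieldDeriv S g (R 0 θ) ∂(volume : Measure E).toSphere) 0 := by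
    refine hasDerivAt_integral_of_continuousOn_deriv isOpen_univ
      (G := fun t (θ : sphere (0 : E) 1) => g (R t θ))
      (G' := fun t (θ : sphere (0 : E) 1) => fieldDeriv S g (R t θ))
      (fun t _ => continuous_iff_continuousAt.2 fun θ => ?_)
      (continuous_iff_continuousAt.2 fun q => ?_).continuousOn (fun t _ θ => ?_) (mem_univ 0)
    · exact (hg _ (hsphere t θ)).continuousAt.comp (f := fun η : sphere (0 : E) 1 => R t η)
        (by fun_prop)
    · exact (contDiffAt_fieldDeriv (m := 0) (hg _ (hsphere q.1 q.2)) le_rfl).continuousAt.comp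
        (f := fun q : ℝ × sphere (0 : E) 1 => R q.1 q.2) (by fun_prop)
    · exact ((hg _ (hsphere t θ)).differentiableAt one_ne_zero).hasFDerivAt.comp_hasDerivAt t
        (hRderiv t θ)
  simp only [integral_toSphere_comp_linearIsometryEquiv (R _).measurePreserving g, hR0] at hderiv
  exact hderiv.unique (hasDerivAt_const _ _)

end Rotation

section Green

variable {E F G H : Type*} [NormedAddCommGroup E] [NormedAddCommGroup F] [NormedSpace ℝ F]
  [NormedAddCommGroup G] [NormedSpace ℝ G] [NormedAddCommGroup H] [NormedSpace ℝ H]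

variable [InnerProductSpace ℝ E] [FiniteDimensional ℝ E] [MeasurableSpace E] [BorelSpace E]
  (B : F →L[ℝ] G →L[ℝ] H) {f : E → F} {g : E → G}

theorem integrable_toSphere_bilin {μ : Measure E} [μ.IsAddHaarMeasure]
    (hf : ∀ x ∈ sphere (0 : E) 1, ContinuousAt f x)
    (hg : ∀ x ∈ sphere (0 : E) 1, ContinuousAt g x) :
    Integrable (fun θ : sphere (0 : E) 1 => B (f θ) (g θ)) μ.toSphere := by
  have hB (θ : sphere (0 : E) 1) : ContinuousAt (fun x => B (f x) (g x)) θ :=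
    (B.continuous.continuousAt.comp (hf θ θ.2)).clm_apply (hg θ θ.2)
  exact (continuous_iff_continuousAt.2 fun θ =>
    (hB θ).comp continuousAt_subtype_val).integrable_of_hasCompactSupport (.of_compactSpace _)

theorem integral_toSphere_bilin_fieldDeriv {S : E →L[ℝ] E} (hS : S ∈ skewAdjoint (E →L[ℝ] E))
    (hf : ∀ x ∈ sphere (0 : E) 1, ContDiffAt ℝ 1 f x)
    (hg : ∀ x ∈ sphere (0 : E) 1, ContDiffAt ℝ 1 g x) :
    ∫ θ : sphere (0 : E) 1, B (fieldDeriv S f θ) (g θ) ∂(volume : Measure E).toSphere =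
      -∫ θ : sphere (0 : E) 1, B (f θ) (fieldDeriv S g θ) ∂(volume : Measure E).toSphere := by
  have hleibniz (θ : sphere (0 : E) 1) := fieldDeriv_bilin S B
    ((hf θ θ.2).differentiableAt one_ne_zero) ((hg θ θ.2).differentiableAt one_ne_zero)
  have hzero := integral_toSphere_fieldDeriv_eq_zero hS (g := fun x => B (f x) (g x)) fun x hx =>
    (B.contDiff.contDiffAt.comp x (hf x hx)).clm_apply (hg x hx)
  simp only [hleibniz] at hzero
  rw [integral_add
    (integrable_toSphere_bilin B (fun x hx => (hf x hx).continuousAt)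
      fun x hx => continuousAt_fieldDeriv (hg x hx))
    (integrable_toSphere_bilin B (fun x hx => continuousAt_fieldDeriv (hf x hx))
      fun x hx => (hg x hx).continuousAt)] at hzero
  exact (neg_eq_of_add_eq_zero_right hzero).symm

theorem integral_toSphere_bilin_fieldDeriv_fieldDeriv {S : E →L[ℝ] E}
    (hS : S ∈ skewAdjoint (E →L[ℝ] E)) (hf : ∀ x ∈ sphere (0 : E) 1, ContDiffAt ℝ 2 f x)
    (hg : ∀ x ∈ sphere (0 : E) 1, ContDiffAt ℝ 2 g x) :
    ∫ θ : sphere (0 : E) 1, B (fieldDeriv S (fieldDeriv S f) θ) (g θ)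
        ∂(volume : Measure E).toSphere =
      ∫ θ : sphere (0 : E) 1, B (f θ) (fieldDeriv S (fieldDeriv S g) θ)
        ∂(volume : Measure E).toSphere := by
  rw [integral_toSphere_bilin_fieldDeriv B hS
      (fun x hx => contDiffAt_fieldDeriv (hf x hx) le_rfl)
      fun x hx => (hg x hx).of_le one_le_two,
    integral_toSphere_bilin_fieldDeriv B hS (fun x hx => (hf x hx).of_le one_le_two)
      fun x hx => contDiffAt_fieldDeriv (hg x hx) le_rfl, neg_neg]

theorem integral_toSphere_bilin_sphericalLaplacian
    (hf : ∀ x ∈ sphere (0 : E) 1, ContDiffAt ℝ 2 f x)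
    (hg : ∀ x ∈ sphere (0 : E) 1, ContDiffAt ℝ 2 g x) :
    ∫ θ : sphere (0 : E) 1, B (sphericalLaplacian f θ) (g θ) ∂(volume : Measure E).toSphere =
      ∫ θ : sphere (0 : E) 1, B (f θ) (sphericalLaplacian g θ)
        ∂(volume : Measure E).toSphere := by
  set S := fun i j => rotationGenerator (stdOrthonormalBasis ℝ E i) (stdOrthonormalBasis ℝ E j)
  have hleft (i j) : Integrable (fun θ : sphere (0 : E) 1 =>
      B (fieldDeriv (S i j) (fieldDeriv (S i j) f) θ) (g θ)) (volume : Measure E).toSphere :=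
    integrable_toSphere_bilin B
      (fun x hx => continuousAt_fieldDeriv (contDiffAt_fieldDeriv (hf x hx) le_rfl))
      fun x hx => (hg x hx).continuousAt
  have hright (i j) : Integrable (fun θ : sphere (0 : E) 1 =>
      B (f θ) (fieldDeriv (S i j) (fieldDeriv (S i j) g) θ)) (volume : Measure E).toSphere :=
    integrable_toSphere_bilin B (fun x hx => (hf x hx).continuousAt)
      fun x hx => continuousAt_fieldDeriv (contDiffAt_fieldDeriv (hg x hx) le_rfl)
  simp only [sphericalLaplacian, map_smul, map_sum, smul_apply, sum_apply, integral_smul]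
  rw [integral_finsetSum _ fun i _ => integrable_finsetSum _ fun j _ => hleft i j,
    integral_finsetSum _ fun i _ => integrable_finsetSum _ fun j _ => hright i j]
  congr! 2 with i
  rw [integral_finsetSum _ fun j _ => hleft i j, integral_finsetSum _ fun j _ => hright i j]
  exact Finset.sum_congr rfl fun j _ => integral_toSphere_bilin_fieldDeriv_fieldDeriv B
    (rotationGenerator_mem_skewAdjoint _ _) hf hg

end Green

section Polynomial

open MvPolynomial

variable {d k : ℕ} {P : MvPolynomial (Fin d) ℂ}

theorem contDiff_evalAt (P : MvPolynomial (Fin d) ℂ) {n : WithTop ℕ∞} :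
    ContDiff ℝ n (evalAt P) := by
  unfold evalAt
  induction P using MvPolynomial.induction_on with
  | C a => simpa using contDiff_const
  | add P Q hP hQ => simpa using hP.add hQ
  | mul_X P j hP =>
    simpa using hP.mul
      (Complex.ofRealCLM.contDiff.comp (EuclideanSpace.proj (𝕜 := ℝ) j).contDiff)

theorem fderiv_evalAt_apply (P : MvPolynomial (Fin d) ℂ) (x v : Euc d) :
    fderiv ℝ (evalAt P) x v = ∑ i, (v i : ℂ) * evalAt (pderiv i P) x := by
  induction P using MvPolynomial.induction_on with
  | C a =>
    rw [show evalAt (C a) = Function.const (Euc d) a by ext; simp [evalAt]]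
    simp [evalAt]
  | add P Q hP hQ =>
    rw [show evalAt (P + Q) = evalAt P + evalAt Q by ext; simp [evalAt],
      fderiv_add ((contDiff_evalAt P).differentiable one_ne_zero _)
        ((contDiff_evalAt Q).differentiable one_ne_zero _)]
    simp [hP, hQ, evalAt, mul_add, Finset.sum_add_distrib]
  | mul_X P j hP =>
    let L : Euc d →L[ℝ] ℂ := Complex.ofRealCLM ∘L EuclideanSpace.proj j
    rw [show evalAt (P * X j) = evalAt P * ⇑L by ext; simp [evalAt, L],
      fderiv_mul ((contDiff_evalAt P).differentiable one_ne_zero _) L.differentiableAt]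
    simp [hP, L, evalAt, pderiv_X, Pi.single_apply, mul_add, Finset.sum_add_distrib, apply_ite,
      Finset.mul_sum, mul_comm, mul_left_comm]

theorem fderiv_evalAt_single (P : MvPolynomial (Fin d) ℂ) (x : Euc d) (i : Fin d) :
    fderiv ℝ (evalAt P) x (EuclideanSpace.single i 1) = evalAt (pderiv i P) x := by
  simp [fderiv_evalAt_apply, PiLp.single_apply, apply_ite Complex.ofReal]

theorem laplacian_evalAt (P : MvPolynomial (Fin d) ℂ) (x : Euc d) :
    Δ (evalAt P) x = evalAt (polyLaplacian d P) x := by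
  have hdiff : DifferentiableAt ℝ (fderiv ℝ (evalAt P)) x :=
    ((contDiff_evalAt P (n := 2)).fderiv_right (m := 1) le_rfl).differentiable one_ne_zero x
  have hsecond (i : Fin d) : fderiv ℝ (fderiv ℝ (evalAt P)) x (EuclideanSpace.single i 1)
      (EuclideanSpace.single i 1) = evalAt (pderiv i (pderiv i P)) x := by
    rw [← fderiv_evalAt_single, ← funext fun y => fderiv_evalAt_single P y i,
      fderiv_clm_apply hdiff (differentiableAt_const _)]
    simp
  simp [laplacian_eq_sum_fderiv_fderiv (EuclideanSpace.basisFun (Fin d) ℝ), hsecond, evalAt,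
    polyLaplacian]

theorem fieldDeriv_one_evalAt (hP : P.IsHomogeneous k) :
    fieldDeriv 1 (evalAt P) = (k : ℝ) • evalAt P := by
  ext x
  simpa [evalAt, fieldDeriv, fderiv_evalAt_apply] using congrArg (evalAt · x) hP.sum_X_mul_pderiv

theorem sphericalLaplacian_evalAt (hP : P ∈ harmonicPoly d k) (x : Euc d) :
    sphericalLaplacian (evalAt P) x = -((k : ℝ) * (k + d - 2)) • evalAt P x := by
  obtain ⟨hhom, hharm⟩ := Submodule.mem_inf.1 hP
  have hlap : Δ (evalAt P) x = 0 := by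
    rw [laplacian_evalAt, LinearMap.mem_ker.1 hharm, evalAt, map_zero]
  have h := norm_sq_smul_laplacian (contDiff_evalAt P).contDiffAt (x := x)
  rw [hlap, fieldDeriv_one_evalAt ((mem_homogeneousSubmodule _ _).1 hhom), fieldDeriv_const_smul,
    fieldDeriv_one_evalAt ((mem_homogeneousSubmodule _ _).1 hhom), finrank_euclideanSpace_fin,
    smul_zero] at h
  rw [← neg_eq_of_add_eq_zero_right h.symm]
  simp only [Pi.smul_apply]
  module

end Polynomial

section FourierLaplace

variable {d k : ℕ} {f g : Euc d → ℂ} {r : ℝ}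

instance : IsFiniteMeasure (sphereMeasure d) :=
  inferInstanceAs (IsFiniteMeasure (volume : Measure (Euc d)).toSphere)

theorem norm_smul_coe_sphere {E : Type*} [SeminormedAddCommGroup E] [NormedSpace ℝ E]
    (hr : 0 ≤ r) (θ : sphere (0 : E) 1) : ‖r • (θ : E)‖ = r := by
  simp [norm_smul, hr]

/-- The real bilinear pairing `(z, w) ↦ z * conj w` under the integral in `flCoeff`. -/
noncomputable def mulConj : ℂ →L[ℝ] ℂ →L[ℝ] ℂ :=
  (ContinuousLinearMap.mul ℝ ℂ).bilinearComp (.id ℝ ℂ)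
    (Complex.conjCLE : ℂ →L[ℝ] ℂ)

theorem mulConj_apply (z w : ℂ) : mulConj z w = z * (starRingEnd ℂ) w := rfl

theorem integrable_flCoeff (hr : 0 ≤ r) (hf : ∀ x, ‖x‖ = r → ContinuousAt f x)
    (P : MvPolynomial (Fin d) ℂ) :
    Integrable (fun θ : sphere (0 : Euc d) 1 =>
      f (r • (θ : Euc d)) * (starRingEnd ℂ) (evalAt P (θ : Euc d))) (sphereMeasure d) :=
  integrable_toSphere_bilin mulConj (f := fun x => f (r • x))
    (fun θ hθ => (hf _ (norm_smul_coe_sphere hr ⟨θ, hθ⟩)).comp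
      (continuous_const_smul r).continuousAt)
    fun _ _ => (contDiff_evalAt P (n := 0)).continuous.continuousAt

theorem flCoeff_add (hr : 0 ≤ r) (hf : ∀ x, ‖x‖ = r → ContinuousAt f x)
    (hg : ∀ x, ‖x‖ = r → ContinuousAt g x) (P : MvPolynomial (Fin d) ℂ) :
    flCoeff (f + g) P r = flCoeff f P r + flCoeff g P r := by
  simp only [flCoeff, Pi.add_apply, add_mul]
  exact integral_add (integrable_flCoeff hr hf P) (integrable_flCoeff hr hg P)

theorem flCoeff_const_smul (c : ℝ) (f : Euc d → ℂ) (P : MvPolynomial (Fin d) ℂ) (r : ℝ) :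
    flCoeff (c • f) P r = c • flCoeff f P r := by
  simp only [flCoeff, Pi.smul_apply, smul_mul_assoc, integral_smul]

theorem flCoeff_congr (hr : 0 ≤ r) (h : ∀ x, ‖x‖ = r → f x = g x) (P : MvPolynomial (Fin d) ℂ) :
    flCoeff f P r = flCoeff g P r :=
  integral_congr_ae <| ae_of_all _ fun θ => by simp only [h _ (norm_smul_coe_sphere hr θ)]

theorem flCoeff_sphericalLaplacian {P : MvPolynomial (Fin d) ℂ} (hP : P ∈ harmonicPoly d k)
    (hr : 0 ≤ r) (hf : ∀ x, ‖x‖ = r → ContDiffAt ℝ 2 f x) :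
    flCoeff (sphericalLaplacian f) P r = -((k : ℝ) * (k + d - 2)) • flCoeff f P r := by
  have hsymm := integral_toSphere_bilin_sphericalLaplacian mulConj (f := fun x => f (r • x))
    (g := evalAt P) (fun θ hθ => (hf _ (norm_smul_coe_sphere hr ⟨θ, hθ⟩)).comp θ
      (contDiffAt_id.const_smul r)) fun _ _ => (contDiff_evalAt P).contDiffAt
  simpa only [sphericalLaplacian_comp_smul, sphericalLaplacian_evalAt hP, map_smul, mulConj_apply,
    integral_smul, flCoeff, sphereMeasure] using hsymm

variable {I : Set ℝ}

theorem hasDerivAt_flCoeff (hI : IsOpen I) (hI0 : I ⊆ Ioi 0)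
    (hf : ∀ x, ‖x‖ ∈ I → ContDiffAt ℝ 1 f x) (P : MvPolynomial (Fin d) ℂ) (hr : r ∈ I) :
    HasDerivAt (flCoeff f P) (r⁻¹ • flCoeff (fieldDeriv 1 f) P r) r := by
  have hnorm {s : ℝ} (hs : s ∈ I) (θ : sphere (0 : Euc d) 1) : ‖s • (θ : Euc d)‖ ∈ I := by
    rwa [norm_smul_coe_sphere (hI0 hs).le]
  have hP : Continuous (evalAt P) := (contDiff_evalAt P (n := 0)).continuous
  rw [flCoeff, ← integral_smul]
  refine hasDerivAt_integral_of_continuousOn_deriv hI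
    (G := fun s (θ : sphere (0 : Euc d) 1) => f (s • (θ : Euc d)) * (starRingEnd ℂ) (evalAt P θ))
    (G' := fun s θ => s⁻¹ • (fieldDeriv 1 f (s • (θ : Euc d)) * (starRingEnd ℂ) (evalAt P θ)))
    (fun s hs => ?_) (fun q hq => ?_) (fun s hs θ => ?_) hr
  · refine continuous_iff_continuousAt.2 fun θ => ?_
    have hfθ := (hf _ (hnorm hs θ)).continuousAt.comp
      (f := fun η : sphere (0 : Euc d) 1 => s • (η : Euc d)) (by fun_prop)
    exact hfθ.mul (by fun_prop)
  · have hfq := (continuousAt_fieldDeriv (A := 1) (hf _ (hnorm hq.1 q.2))).comp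
      (f := fun q : ℝ × sphere (0 : Euc d) 1 => q.1 • (q.2 : Euc d)) (by fun_prop)
    have hq0 : q.1 ≠ 0 := (hI0 hq.1).ne'
    exact ((continuousAt_fst.inv₀ hq0).smul (hfq.mul (by fun_prop))).continuousWithinAt
  · have hray : HasDerivAt (fun t : ℝ => t • (θ : Euc d)) (θ : Euc d) s := by
      simpa using (hasDerivAt_id s).smul_const (θ : Euc d)
    have hs0 : s ≠ 0 := (hI0 hs).ne'
    have hfray : HasDerivAt (fun t : ℝ => f (t • (θ : Euc d)))
        (s⁻¹ • fieldDeriv 1 f (s • (θ : Euc d))) s := by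
      simpa [fieldDeriv, hs0, Function.comp_def] using
        ((hf _ (hnorm hs θ)).differentiableAt one_ne_zero).hasFDerivAt.comp_hasDerivAt s hray
    simpa only [smul_mul_assoc] using hfray.mul_const ((starRingEnd ℂ) (evalAt P θ))

theorem contDiffOn_flCoeff (hI : IsOpen I) (hI0 : I ⊆ Ioi 0)
    (hf : ∀ x, ‖x‖ ∈ I → ContDiffAt ℝ ∞ f x) (P : MvPolynomial (Fin d) ℂ) :
    ContDiffOn ℝ ∞ (flCoeff f P) I := by
  refine contDiffOn_infty.2 fun n => ?_
  have hderiv {f : Euc d → ℂ} (hf : ∀ x, ‖x‖ ∈ I → ContDiffAt ℝ ∞ f x) {r : ℝ} (hr : r ∈ I) :=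
    hasDerivAt_flCoeff hI hI0 (fun x hx => (hf x hx).of_le (mod_cast le_top)) P hr
  induction n generalizing f with
  | zero => exact contDiffOn_zero.2 fun r hr => (hderiv hf hr).continuousAt.continuousWithinAt
  | succ n ih =>
    refine (contDiffOn_succ_iff_deriv_of_isOpen (n := n) hI).2
      ⟨fun r hr => (hderiv hf hr).differentiableAt.differentiableWithinAt, by simp, ?_⟩
    refine ContDiffOn.congr ?_ fun r hr => (hderiv hf hr).deriv
    exact (contDiffOn_id.inv fun r hr => (hI0 hr).ne').smul
      (ih fun x hx => contDiffAt_fieldDeriv (hf x hx) le_rfl)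

theorem sq_smul_flCoeff_laplacian {P : MvPolynomial (Fin d) ℂ} (hP : P ∈ harmonicPoly d k)
    (hr : 0 ≤ r) (hf : ∀ x, ‖x‖ = r → ContDiffAt ℝ 2 f x) :
    r ^ 2 • flCoeff (Δ f) P r = flCoeff (fieldDeriv 1 (fieldDeriv 1 f)) P r
      + ((d : ℝ) - 2) • flCoeff (fieldDeriv 1 f) P r
      + -((k : ℝ) * (k + d - 2)) • flCoeff f P r := by
  have hf1 : ∀ x, ‖x‖ = r → ContDiffAt ℝ 1 (fieldDeriv 1 f) x :=
    fun x hx => contDiffAt_fieldDeriv (hf x hx) le_rfl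
  have hc1 : ∀ x, ‖x‖ = r → ContinuousAt (((d : ℝ) - 2) • fieldDeriv 1 f) x :=
    fun x hx => (hf1 x hx).continuousAt.const_smul _
  have hc2 : ∀ x, ‖x‖ = r → ContinuousAt (fieldDeriv 1 (fieldDeriv 1 f)) x :=
    fun x hx => continuousAt_fieldDeriv (hf1 x hx)
  have hcS : ∀ x, ‖x‖ = r → ContinuousAt (sphericalLaplacian f) x :=
    fun x hx => continuousAt_sphericalLaplacian (hf x hx)
  rw [← flCoeff_sphericalLaplacian hP hr hf, ← flCoeff_const_smul, ← flCoeff_const_smul,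
    ← flCoeff_add hr hc2 hc1 P, ← flCoeff_add hr (fun x hx => (hc2 x hx).add (hc1 x hx)) hcS P]
  refine flCoeff_congr hr (fun x hx => ?_) P
  simpa [hx] using norm_sq_smul_laplacian (hf x hx)

theorem radialOp_flCoeff (hI : IsOpen I) (hI0 : I ⊆ Ioi 0)
    (hf : ∀ x, ‖x‖ ∈ I → ContDiffAt ℝ 2 f x) {P : MvPolynomial (Fin d) ℂ}
    (hP : P ∈ harmonicPoly d k) (hr : r ∈ I) :
    radialOp d k (flCoeff f P) r = flCoeff (Δ f) P r := by
  have hr0 : 0 < r := hI0 hr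
  have hf1 : ∀ x, ‖x‖ ∈ I → ContDiffAt ℝ 1 (fieldDeriv 1 f) x :=
    fun x hx => contDiffAt_fieldDeriv (hf x hx) le_rfl
  have hderiv : ∀ s ∈ I, deriv (flCoeff f P) s = s⁻¹ • flCoeff (fieldDeriv 1 f) P s :=
    fun s hs => (hasDerivAt_flCoeff hI hI0 (fun x hx => (hf x hx).of_le one_le_two) P hs).deriv
  have hderiv2 : deriv (deriv (flCoeff f P)) r =
      r⁻¹ • r⁻¹ • flCoeff (fieldDeriv 1 (fieldDeriv 1 f)) P r
        + (-(r ^ 2)⁻¹) • flCoeff (fieldDeriv 1 f) P r :=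
    ((hasDerivAt_inv hr0.ne').smul (hasDerivAt_flCoeff hI hI0 hf1 P hr)
      |>.congr_of_eventuallyEq (eventually_of_mem (hI.mem_nhds hr) hderiv)).deriv
  rw [radialOp, hderiv2, hderiv r hr, ← inv_smul_smul₀ (pow_ne_zero 2 hr0.ne') (flCoeff (Δ f) P r),
    sq_smul_flCoeff_laplacian hP hr0.le fun x hx => hf x (hx ▸ hr)]
  simp only [Complex.real_smul]
  push_cast
  field_simp
  ring

theorem radialOp_congr {F G : ℝ → ℂ} (h : F =ᶠ[𝓝 r] G) : radialOp d k F r = radialOp d k G r := by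
  simp only [radialOp, h.deriv.deriv_eq, h.deriv_eq, h.eq_of_nhds]

theorem radialOp_iterate_flCoeff (hI : IsOpen I) (hI0 : I ⊆ Ioi 0)
    (hf : ∀ x, ‖x‖ ∈ I → ContDiffAt ℝ ∞ f x) {P : MvPolynomial (Fin d) ℂ}
    (hP : P ∈ harmonicPoly d k) (p : ℕ) :
    EqOn ((radialOp d k)^[p] (flCoeff f P)) (flCoeff ((fun g : Euc d → ℂ => Δ g)^[p] f) P) I := by
  induction p with
  | zero => exact fun _ _ => rfl
  | succ p ih =>
    intro r hr
    rw [Function.iterate_succ_apply', Function.iterate_succ_apply',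
      radialOp_congr (eventually_of_mem (hI.mem_nhds hr) ih)]
    exact radialOp_flCoeff hI hI0
      (fun x hx => (contDiffAt_laplacian_iterate (hf x hx) p).of_le (WithTop.coe_le_coe.2 le_top))
      hP hr

theorem integral_norm_le_sqrt_mul_sqrt {α F : Type*} [MeasurableSpace α] {μ : Measure α}
    [IsFiniteMeasure μ] [NormedAddCommGroup F] {h : α → F} (hh : MemLp h 2 μ) :
    ∫ x, ‖h x‖ ∂μ ≤ √(μ.real univ) * √(∫ x, ‖h x‖ ^ 2 ∂μ) := by
  have hholder := integral_mul_le_Lp_mul_Lq_of_nonneg (μ := μ) Real.HolderConjugate.two_two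
    (f := fun _ => (1 : ℝ)) (g := fun x => ‖h x‖) (ae_of_all _ fun _ => zero_le_one)
    (ae_of_all _ fun _ => norm_nonneg _) (memLp_const 1) (by simpa using hh.norm)
  simpa [Real.sqrt_eq_rpow] using hholder

theorem norm_flCoeff_le {M : ℝ} (hr : 0 ≤ r) (hM0 : 0 ≤ M) (hM : ∀ x, ‖x‖ = r → ‖f x‖ ≤ M)
    (P : MvPolynomial (Fin d) ℂ) :
    ‖flCoeff f P r‖ ≤
      M * (√(sphereArea d) * √(∫ θ, ‖evalAt P (θ : Euc d)‖ ^ 2 ∂(sphereMeasure d))) := by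
  have hP : Continuous fun θ : sphere (0 : Euc d) 1 => evalAt P θ :=
    (contDiff_evalAt P (n := 0)).continuous.comp continuous_subtype_val
  calc ‖flCoeff f P r‖ ≤ ∫ θ : sphere (0 : Euc d) 1, M * ‖evalAt P θ‖ ∂(sphereMeasure d) := by
        refine norm_integral_le_of_norm_le
          ((hP.norm.integrable_of_hasCompactSupport (.of_compactSpace _)).const_mul M)
          (ae_of_all _ fun θ => ?_)
        rw [norm_mul, RCLike.norm_conj]
        gcongr
        exact hM _ (norm_smul_coe_sphere hr θ)
    _ = M * ∫ θ : sphere (0 : Euc d) 1, ‖evalAt P θ‖ ∂(sphereMeasure d) := integral_const_mul _ _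
    _ ≤ _ := mul_le_mul_of_nonneg_left (integral_norm_le_sqrt_mul_sqrt
        (hP.memLp_of_hasCompactSupport (.of_compactSpace _))) hM0

end FourierLaplace

section Annulus

theorem isOpen_radii (r₀ : ℝ) (r₁ : EReal) : IsOpen (radii r₀ r₁) :=
  (isOpen_lt continuous_const continuous_id).inter
    (isOpen_lt continuous_coe_real_ereal continuous_const)

theorem isOpen_annulus (d : ℕ) (r₀ : ℝ) (r₁ : EReal) : IsOpen (annulus d r₀ r₁) :=
  (isOpen_radii r₀ r₁).preimage continuous_norm

theorem isCompact_norm_mem_Icc {E : Type*} [SeminormedAddCommGroup E] [ProperSpace E] (a b : ℝ) :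
    IsCompact {x : E | ‖x‖ ∈ Icc a b} :=
  (isCompact_closedBall 0 b).of_isClosed_subset (isClosed_Icc.preimage continuous_norm)
    fun _ hx => mem_closedBall_zero_iff.2 hx.2

variable {d : ℕ} {Y : (k : ℕ) → Fin (harmonicDim d k) → MvPolynomial (Fin d) ℂ}

theorem IsSphericalBasis.mem_harmonicPoly (hY : IsSphericalBasis d Y) (k : ℕ)
    (l : Fin (harmonicDim d k)) : Y k l ∈ harmonicPoly d k :=
  hY.span_eq k ▸ Submodule.subset_span ⟨l, rfl⟩

theorem IsSphericalBasis.integral_norm_sq (hY : IsSphericalBasis d Y) (k : ℕ)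
    (l : Fin (harmonicDim d k)) :
    ∫ θ, ‖evalAt (Y k l) (θ : Euc d)‖ ^ 2 ∂(sphereMeasure d) = 1 := by
  have h := hY.orthonormal k l l
  simp only [Complex.mul_conj', ↓reduceIte] at h
  exact_mod_cast h

end Annulus

end Polyharmonic

section

open Polyharmonic Set

theorem mainTheorem11_general {d : ℕ} {r₀ : ℝ} {r₁ : EReal} (hr₀ : 0 ≤ r₀) {f : Euc d → ℂ} {τ : ℝ}
    (hf : IsPolyharmonicInf (annulus d r₀ r₁) τ f) :
    (∀ P : MvPolynomial (Fin d) ℂ, ContDiffOn ℝ ∞ (flCoeff f P) (radii r₀ r₁)) ∧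
    ∀ a b : ℝ, Icc a b ⊆ radii r₀ r₁ → ∀ ε : ℝ, 0 < ε →
      ∃ C : ℝ, 0 < C ∧ ∀ k : ℕ, ∀ P ∈ harmonicPoly d k, ∀ r ∈ Icc a b, ∀ p : ℕ,
        ‖((radialOp d k)^[p] (flCoeff f P)) r‖ ≤
          C * √(sphereArea d) * ((2 * p).factorial : ℝ) * (τ + ε) ^ (2 * p)
            * √(∫ θ, ‖evalAt P (θ : Euc d)‖ ^ 2 ∂(sphereMeasure d)) := by
  have hpos : radii r₀ r₁ ⊆ Ioi 0 := fun r hr => hr₀.trans_lt hr.1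
  have hsmooth (x : Euc d) (hx : ‖x‖ ∈ radii r₀ r₁) : ContDiffAt ℝ ∞ f x :=
    hf.1.contDiffAt ((isOpen_annulus d r₀ r₁).mem_nhds hx)
  refine ⟨contDiffOn_flCoeff (isOpen_radii r₀ r₁) hpos hsmooth, fun a b hab ε hε => ?_⟩
  obtain ⟨C, hC, hbound⟩ := hf.2 _ (isCompact_norm_mem_Icc a b) (fun x hx => hab hx) ε hε
  refine ⟨C, hC, fun k P hP r hr p => ?_⟩
  have hM : 0 ≤ C * ((2 * p).factorial : ℝ) * (τ + ε) ^ (2 * p) :=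
    mul_nonneg (by positivity) ((even_two_mul p).pow_nonneg _)
  rw [radialOp_iterate_flCoeff (isOpen_radii r₀ r₁) hpos hsmooth hP p (hab hr)]
  refine (norm_flCoeff_le (hpos (hab hr)).le hM (fun x hx => hbound p x ?_) P).trans_eq (by ring)
  rwa [mem_ofPred_eq, hx]

end

theorem mainTheorem11 (d : ℕ) (hd : 2 ≤ d) (r₀ : ℝ) (r₁ : EReal) (hr₀ : 0 ≤ r₀)
    (hr : (r₀ : EReal) < r₁)
    (Y : (k : ℕ) → Fin (Polyharmonic.harmonicDim d k) → MvPolynomial (Fin d) ℂ)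
    (hY : Polyharmonic.IsSphericalBasis d Y)
    (f : Polyharmonic.Euc d → ℂ) (τ : ℝ) (hτ : 0 ≤ τ)
    (hf : Polyharmonic.IsPolyharmonicInf (Polyharmonic.annulus d r₀ r₁) τ f) :
    (∀ (k : ℕ) (l : Fin (Polyharmonic.harmonicDim d k)),
      ContDiffOn ℝ ∞ (Polyharmonic.flCoeff f (Y k l)) (Polyharmonic.radii r₀ r₁)) ∧
    ∀ a b : ℝ, Set.Icc a b ⊆ Polyharmonic.radii r₀ r₁ → ∀ ε : ℝ, 0 < ε →
      ∃ C : ℝ, 0 < C ∧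
        ∀ (k : ℕ) (l : Fin (Polyharmonic.harmonicDim d k)), ∀ r ∈ Set.Icc a b, ∀ p : ℕ,
          ‖((Polyharmonic.radialOp d k)^[p] (Polyharmonic.flCoeff f (Y k l))) r‖
            ≤ C * Real.sqrt (Polyharmonic.sphereArea d) * ((2 * p).factorial : ℝ)
              * (τ + ε) ^ (2 * p) := by
  obtain ⟨hsmooth, hbound⟩ := mainTheorem11_general hr₀ hf
  refine ⟨fun k l => hsmooth (Y k l), fun a b hab ε hε => ?_⟩
  obtain ⟨C, hC, hCbound⟩ := hbound a b hab ε hε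
  refine ⟨C, hC, fun k l r hr p => ?_⟩
  simpa [hY.integral_norm_sq] using hCbound k (Y k l) (hY.mem_harmonicPoly k l) r hr p
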